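/- Let $\mathcal A$ be the set of isotopy classes of (non-empty) oriented links. For $L\in\mathcal A$ let $\nabla(L),V(L),D(L)\in\mathbb C[s,s^{-1}]$ be the link invariants with value $1$ on the unknot that satisfy, for all oriented link diagrams $L_+,L_-,L_0$ that agree except near one crossing, which is positive in $L_+$, negative in $L_-$ and smoothed compatibly with the orientation in $L_0$, the skein relation $$l\,P(L_+)+l^{-1}P(L_-)+m\,P(L_0)=0,$$ where - $P=\nabla$ (Alexander–Conway polynomial): $l=i,\ m=i(s^{-1}-s)$, the value on the two-component unlink being $0$; - $P=V$ (Jones polynomial): $l=i s^{2},\ m=i(s-s^{-1})$; - $P=D$ (degenerate polynomial): $l=s,\ m=-2$. In other words, they are the corresponding specializations of the HOMFLY polynomial. **Theorem.** The families $\nabla$, $V$, $D$ are algebraically independent over $\mathbb C[s,s^{-1}]$: if $\Phi\in\mathbb C[s,s^{-1}][T_1,T_2,T_3]$ satisfies $\Phi(\nabla(L),V(L),D(L))=0$ for every $L\in\mathcal A$, then $\Phi=0$. -/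

import Mathlib

open scoped LaurentPolynomial

/-- A passage of a strand through a crossing: the label of the crossing, together with `true` for
the passage along the overcrossing strand and `false` for the one along the undercrossing strand. -/
abbrev Passage := ℕ × Bool

/-- An oriented signed Gauss code.  Every component of the link is the list of the passages met
when it is travelled once along its orientation, starting at a base point; a component without
crossings is the empty list.  `sign k = true` says that the crossing `k` is positive. -/
structure GaussCode where
  comps : List (List Passage)
  sign : ℕ → Bool

namespace GaussCode

variable (G : GaussCode)

/-- All passages, in the order in which they are met. -/
def passages : List Passage := G.comps.flatten

/-- The number of crossings (each crossing has exactly one overpassage). -/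
def crossings : ℕ := G.passages.countP (fun x => x.2)

/-- There is at least one component, every passage occurs once, and each crossing that occurs has
both an overpassage and an underpassage. -/
def WellFormed : Prop :=
  G.comps ≠ [] ∧ G.passages.Nodup ∧ ∀ k, (k, true) ∈ G.passages ↔ (k, false) ∈ G.passages

/-! ### Planarity

The code determines a 4-valent graph whose vertices are the crossings and whose edges are the
pieces of strand between consecutive passages, with a cyclic order of the edges at each vertex
(determined by the sign).  It comes from a diagram in the plane iff each connected component of
the surface obtained by glueing discs along the boundary walks of this ribbon graph is a sphere,
that is, iff `V - E + F = 2 K`, where `K` is the number of connected components of the graph.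
(The left side is `∑ (2 - 2 gᵢ)`, so that the equation says that all genera `gᵢ` vanish.
Components without crossings play no role here.) -/

/-- The next passage on the same component, cyclically.  An edge is named by the passage at which
it starts, so that the edge named `x` runs from `x` to `G.next x`. -/
def next : Equiv.Perm Passage := (G.comps.map List.formPerm).prod

/-- The edge that ends at the passage `x`. -/
def prev (x : Passage) : Passage := G.next.symm x

/-- Draw the crossing `k` with both strands going upwards: `G.ne k` is the passage along the strand
from the bottom left to the top right.  This is the overcrossing strand iff `k` is positive. -/
def ne (k : ℕ) : Passage := (k, G.sign k)

/-- The passage along the strand that goes from the bottom right to the top left. -/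
def nw (k : ℕ) : Passage := (k, !G.sign k)

/-- The edges with a chosen side: `(e, true)` is the left side and `(e, false)` the right side of
the edge `e`, with respect to its orientation.  Two such sides are related if they bound the same
one of the four corners at a crossing. -/
inductive SameCorner : Passage × Bool → Passage × Bool → Prop
  | north (k : ℕ) : SameCorner (G.ne k, true) (G.nw k, false)
  | west (k : ℕ) : SameCorner (G.nw k, true) (G.prev (G.ne k), true)
  | south (k : ℕ) : SameCorner (G.prev (G.ne k), false) (G.prev (G.nw k), true)
  | east (k : ℕ) : SameCorner (G.prev (G.nw k), false) (G.ne k, false)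

/-- The number of faces: classes of sides of edges under the equivalence relation generated
by `SameCorner`. -/
noncomputable def faces : ℕ :=
  Nat.card (Quot fun p q : {x // x ∈ G.passages} × Bool =>
    G.SameCorner (p.1.1, p.2) (q.1.1, q.2))

/-- The number of connected components of the underlying 4-valent graph. -/
noncomputable def pieces : ℕ :=
  Nat.card (Quot fun p q : {x // x ∈ G.passages} => q.1 = G.next p.1 ∨ q.1.1 = p.1.1)

/-- Euler's formula `V + F = E + 2 K`. -/
def Planar : Prop := G.crossings + G.faces = G.passages.length + 2 * G.pieces

/-! ### Skein moves -/

/-- The crossing change at `k`. -/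
def switch (k : ℕ) : GaussCode where
  comps := G.comps.map (List.map fun x => if x.1 = k then (x.1, !x.2) else x)
  sign := Function.update G.sign k (!G.sign k)

/-- Does the component `w` pass through the crossing `k`? -/
def meets (k : ℕ) (w : List Passage) : Bool := w.any (fun x => x.1 == k)

/-- The part of `w` before its first passage through `k`. -/
def before (k : ℕ) (w : List Passage) : List Passage := w.takeWhile (fun x => x.1 != k)

/-- The part of `w` after its first passage through `k`. -/
def after (k : ℕ) (w : List Passage) : List Passage := (w.dropWhile (fun x => x.1 != k)).tail

/-- Orientation preserving smoothing of the crossing `k`.  A component `A k B k C` is split into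
`A C` and `B`; two distinct components `A k B` and `C k D` are joined to `A D C B`. -/
def smoothComps (k : ℕ) : List (List Passage) → List (List Passage)
  | [] => []
  | w :: ws =>
    if meets k w then
      if meets k (after k w) then
        (before k w ++ after k (after k w)) :: before k (after k w) :: ws
      else
        (before k w ++ (ws.filter (meets k)).flatMap (fun v => after k v ++ before k v)
          ++ after k w) :: ws.filter (fun v => !meets k v)
    else w :: smoothComps k ws

/-- The diagram with the crossing `k` smoothed. -/
def smooth (k : ℕ) : GaussCode where
  comps := smoothComps k G.comps
  sign := G.sign

/-- The crossings that are met first along their undercrossing strand, when the components are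
travelled in the given order from their base points.  If there are none, the diagram is
descending, hence a diagram of an unlink. -/
def badCrossings : List ℕ :=
  (G.passages.filter fun x =>
    !x.2 && decide (G.passages.idxOf x < G.passages.idxOf (x.1, true))).map Prod.fst

end GaussCode

/-- The coefficients of a skein relation `l P(L₊) + l⁻¹ P(L₋) + m P(L₀) = 0`, with the value
`δ = -(l + l⁻¹) / m` of a distant unknotted circle (which is the value of the two-component
unlink). -/
structure SkeinParams (R : Type*) [CommRing R] where
  l : R
  linv : R
  m : R
  δ : R
  l_mul_linv : l * linv = 1
  loop : l + linv + m * δ = 0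

namespace SkeinParams

variable {R : Type*} [CommRing R] (S : SkeinParams R)

/-- The value of an unlink with as many components as `G`. -/
def unlink (G : GaussCode) : R := S.δ ^ (G.comps.length - 1)

/-- Change the crossings of a list one after the other.  The skein relation expresses the value
before a crossing change by the value after it and the value `ev` of the smoothed diagram; when the
list is exhausted, the diagram is descending and has the value of an unlink. -/
def resolve (ev : GaussCode → R) : List ℕ → GaussCode → R
  | [], G => S.unlink G
  | k :: ks, G =>
    if G.sign k then
      -(S.linv * (S.linv * resolve ev ks (G.switch k) + S.m * ev (G.smooth k)))
    else
      -(S.l * (S.l * resolve ev ks (G.switch k) + S.m * ev (G.smooth k)))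

/-- The value of a diagram with at most `n` crossings. -/
def evalAux : ℕ → GaussCode → R
  | 0, G => S.unlink G
  | n + 1, G => S.resolve (evalAux n) G.badCrossings G

/-- The HOMFLY polynomial at the parameters `S`, computed from its normalization and its skein
relation: the crossings that prevent the diagram from being descending are changed in turn, and
the smoothed diagrams, which have fewer crossings, are treated recursively. -/
def homfly (G : GaussCode) : R := S.evalAux G.crossings G

end SkeinParams

/-- An oriented link diagram in the plane, with a base point on each component and an order of the
components, encoded by its signed Gauss code.  Two diagrams which differ only in the relative
position of connected pieces of the diagram have the same code; they are diagrams of the same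
link. -/
structure LinkDiagram where
  code : GaussCode
  wellFormed : code.WellFormed
  planar : code.Planar

open LaurentPolynomial in
/-- Alexander-Conway: `l = i`, `m = i (s⁻¹ - s)`. -/
noncomputable def conwayParams : SkeinParams ℂ[T;T⁻¹] where
  l := C Complex.I
  linv := C (-Complex.I)
  m := C Complex.I * (T (-1) - T 1)
  δ := 0
  l_mul_linv := by rw [← map_mul]; simp
  loop := by rw [← map_add]; simp

open LaurentPolynomial in
/-- Jones: `l = i s²`, `m = i (s - s⁻¹)`. -/
noncomputable def jonesParams : SkeinParams ℂ[T;T⁻¹] where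
  l := C Complex.I * T 2
  linv := C (-Complex.I) * T (-2)
  m := C Complex.I * (T 1 - T (-1))
  δ := -(T 1 + T (-1))
  l_mul_linv := by
    rw [mul_mul_mul_comm, ← map_mul, ← T_add]; simp
  loop := by
    have h2 : (T 2 : ℂ[T;T⁻¹]) = T 1 * T 1 := by rw [← T_add]; norm_num
    have h3 : (T (-2) : ℂ[T;T⁻¹]) = T (-1) * T (-1) := by rw [← T_add]; norm_num
    rw [h2, h3, map_neg]; ring

open LaurentPolynomial in
/-- The degenerate polynomial: `l = s`, `m = -2`. -/
noncomputable def degenerateParams : SkeinParams ℂ[T;T⁻¹] where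
  l := T 1
  linv := T (-1)
  m := -2
  δ := C (1 / 2) * (T 1 + T (-1))
  l_mul_linv := by rw [← T_add]; simp
  loop := by
    have h : (2 : ℂ[T;T⁻¹]) * C (1 / 2) = 1 := by
      rw [← map_ofNat (C : ℂ →+* ℂ[T;T⁻¹]) 2, ← map_mul]; simp
    linear_combination (-(T 1 + T (-1)) : ℂ[T;T⁻¹]) * h

/-- The Alexander-Conway polynomial. -/
noncomputable def alexanderConway (L : LinkDiagram) : ℂ[T;T⁻¹] := conwayParams.homfly L.code

/-- The Jones polynomial. -/
noncomputable def jones (L : LinkDiagram) : ℂ[T;T⁻¹] := jonesParams.homfly L.code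

/-- The degenerate polynomial `D`. -/
noncomputable def degenerate (L : LinkDiagram) : ℂ[T;T⁻¹] := degenerateParams.homfly L.code

/-! ### Strands carrying a row of clasps. -/

open scoped LaurentPolynomial

/-! Connected sums of positive Hopf links already suffice. On the sum of `n` of them each invariant
takes the value `h ^ n`, where `h` is its value on one Hopf link (`SkeinParams.homfly_hopfSum`). A
relation Φ therefore gives, for every `n`, a vanishing combination of the `n`-th powers of the
monomials in the three Hopf values, with the coefficients of Φ. If these monomials are pairwise
distinct, the maps `n ↦ (monomial) ^ n` are distinct characters of ℕ, and Dedekind's theorem makes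
all coefficients zero (`algebraicIndependent_of_pow`). The monomials are distinct because each Hopf
value has a zero in `ℂˣ` at which the other two do not vanish (`injective_monomials_hopf`).

The skein computation takes place in a family of codes closed under the moves of the algorithm: a
main component whose clasps are each linked with a ring, lie over a free ring, or have become a kink
(`resolve_claspCode`). Planarity is Euler's formula, for which the faces are counted explicitly
(`hopfChain_faces`). -/

/-- The states through which a clasp passes in the evaluation of a connected sum of Hopf links. -/
inductive ClaspState
  | clasped
  | unlinked
  | kink
  deriving DecidableEq

namespace ClaspState

/-- The passages of the main component through a clasp. -/
def mainArc : ℕ × ClaspState → List Passage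
  | (i, clasped) => [(2 * i, true), (2 * i + 1, false)]
  | (i, unlinked) => [(2 * i, true), (2 * i + 1, true)]
  | (i, kink) => [(2 * i, true), (2 * i, false)]

/-- The ring around the main component at a clasp. -/
def ring : ℕ × ClaspState → List (List Passage)
  | (i, clasped) => [[(2 * i, false), (2 * i + 1, true)]]
  | (i, unlinked) => [[(2 * i, false), (2 * i + 1, false)]]
  | (_, kink) => []

/-- The crossing of a clasp that is first met along its undercrossing strand. -/
def bad : ℕ × ClaspState → List ℕ
  | (i, clasped) => [2 * i + 1]
  | _ => []

theorem fst_of_mem_mainArc {c : ℕ × ClaspState} {x : Passage} (hx : x ∈ mainArc c) :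
    x.1 = 2 * c.1 ∨ x.1 = 2 * c.1 + 1 := by
  obtain ⟨i, _ | _ | _⟩ := c <;> simp [mainArc] at hx <;> rcases hx with rfl | rfl <;> simp

theorem fst_of_mem_ring {c : ℕ × ClaspState} {w : List Passage} (hw : w ∈ ring c) {x : Passage}
    (hx : x ∈ w) : x.1 = 2 * c.1 ∨ x.1 = 2 * c.1 + 1 := by
  obtain ⟨i, _ | _ | _⟩ := c <;> simp [ring] at hw <;> subst hw <;> simp at hx <;>
    rcases hx with rfl | rfl <;> simp

end ClaspState

open ClaspState

/-- A component with a sequence of clasps, each with a ring that it may link. -/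
def claspCode (σ : List (ℕ × ClaspState)) (sgn : ℕ → Bool) : GaussCode where
  comps := σ.flatMap mainArc :: σ.flatMap ring
  sign := sgn

/-! ### Crossing change and smoothing at a clasp. -/

section Moves

variable {σ τ : List (ℕ × ClaspState)} {i : ℕ}

theorem fst_ne_of_mem_flatMap_mainArc (h : i ∉ σ.map Prod.fst) {x : Passage}
    (hx : x ∈ σ.flatMap mainArc) : x.1 ≠ 2 * i + 1 := by
  obtain ⟨c, hc, hx⟩ := List.mem_flatMap.1 hx
  rintro h'
  apply h
  rw [List.mem_map]
  refine ⟨c, hc, ?_⟩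
  rcases fst_of_mem_mainArc hx with h1 | h1 <;> omega

theorem fst_ne_of_mem_flatMap_ring (h : i ∉ σ.map Prod.fst) {w : List Passage}
    (hw : w ∈ σ.flatMap ring) {x : Passage} (hx : x ∈ w) : x.1 ≠ 2 * i + 1 := by
  obtain ⟨c, hc, hw⟩ := List.mem_flatMap.1 hw
  rintro h'
  apply h
  rw [List.mem_map]
  refine ⟨c, hc, ?_⟩
  rcases fst_of_mem_ring hw hx with h1 | h1 <;> omega

theorem map_switch_of_forall_ne {k : ℕ} {w : List Passage} (h : ∀ x ∈ w, x.1 ≠ k) :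
    w.map (fun x : Passage => if x.1 = k then (x.1, !x.2) else x) = w := by
  conv_rhs => rw [← List.map_id w]
  exact List.map_congr_left fun x hx => by simp [h x hx]

/-- After the change the main strand is over at both crossings, so the ring comes off. No other arc
or ring carries the label `2 * i + 1`. -/
theorem claspCode_switch (hσ : i ∉ σ.map Prod.fst) (hτ : i ∉ τ.map Prod.fst) (sgn : ℕ → Bool) :
    (claspCode (σ ++ (i, clasped) :: τ) sgn).switch (2 * i + 1) =
      claspCode (σ ++ (i, unlinked) :: τ)
        (Function.update sgn (2 * i + 1) (!sgn (2 * i + 1))) := by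
  have rings : ∀ ρ : List (ℕ × ClaspState), i ∉ ρ.map Prod.fst →
      (ρ.flatMap ring).map (List.map fun x : Passage =>
        if x.1 = 2 * i + 1 then (x.1, !x.2) else x) = ρ.flatMap ring := fun ρ hρ => by
    conv_rhs => rw [← List.map_id (ρ.flatMap ring)]
    exact List.map_congr_left fun w hw =>
      map_switch_of_forall_ne fun x hx => fst_ne_of_mem_flatMap_ring hρ hw hx
  simp only [GaussCode.switch, claspCode, List.flatMap_append, List.flatMap_cons, List.map_cons,
    List.map_append, rings σ hσ, rings τ hτ,
    map_switch_of_forall_ne fun x => fst_ne_of_mem_flatMap_mainArc hσ,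
    map_switch_of_forall_ne fun x => fst_ne_of_mem_flatMap_mainArc hτ]
  simp [mainArc, ring]

theorem GaussCode.meets_eq_false {k : ℕ} {w : List Passage} (h : ∀ x ∈ w, x.1 ≠ k) :
    GaussCode.meets k w = false := by
  simpa [GaussCode.meets] using fun a b hab => h (a, b) hab

/-- The crossing joins the main component to a ring, so smoothing inserts what is left of the ring,
the underpassage of `2 * i`, right after the overpassage of `2 * i`. -/
theorem claspCode_smooth (hσ : i ∉ σ.map Prod.fst) (hτ : i ∉ τ.map Prod.fst) (sgn : ℕ → Bool) :
    (claspCode (σ ++ (i, clasped) :: τ) sgn).smooth (2 * i + 1) =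
      claspCode (σ ++ (i, kink) :: τ) sgn := by
  have e : (σ ++ (i, clasped) :: τ).flatMap mainArc =
      (σ.flatMap mainArc ++ [(2 * i, true)]) ++ (2 * i + 1, false) :: τ.flatMap mainArc := by
    simp [mainArc]
  have hpre : ∀ x ∈ σ.flatMap mainArc ++ [(2 * i, true)], x.1 ≠ 2 * i + 1 := by
    intro x hx
    rcases List.mem_append.1 hx with hx | hx
    · exact fst_ne_of_mem_flatMap_mainArc hσ hx
    · simp only [List.mem_singleton] at hx
      subst hx
      simp
  have hpre' : ∀ x ∈ σ.flatMap mainArc ++ [(2 * i, true)], (x.1 != 2 * i + 1) = true :=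
    fun x hx => by simpa using hpre x hx
  have hb : GaussCode.before (2 * i + 1) ((σ ++ (i, clasped) :: τ).flatMap mainArc) =
      σ.flatMap mainArc ++ [(2 * i, true)] := by
    rw [e, GaussCode.before, List.takeWhile_append_of_pos hpre']
    simp
  have ha : GaussCode.after (2 * i + 1) ((σ ++ (i, clasped) :: τ).flatMap mainArc) =
      τ.flatMap mainArc := by
    rw [e, GaussCode.after, List.dropWhile_append_of_pos hpre']
    simp
  have hm : GaussCode.meets (2 * i + 1) ((σ ++ (i, clasped) :: τ).flatMap mainArc) = true := by
    simp [e, GaussCode.meets]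
  have hm' : GaussCode.meets (2 * i + 1) (τ.flatMap mainArc) = false :=
    GaussCode.meets_eq_false fun x hx => fst_ne_of_mem_flatMap_mainArc hτ hx
  have rings : ∀ ρ : List (ℕ × ClaspState), i ∉ ρ.map Prod.fst → ∀ w ∈ ρ.flatMap ring,
      GaussCode.meets (2 * i + 1) w = false := fun ρ hρ w hw =>
    GaussCode.meets_eq_false fun x hx => fst_ne_of_mem_flatMap_ring hρ hw hx
  have f1 : ∀ ρ : List (ℕ × ClaspState), i ∉ ρ.map Prod.fst →
      (ρ.flatMap ring).filter (GaussCode.meets (2 * i + 1)) = [] := fun ρ hρ => by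
    rw [List.filter_eq_nil_iff]
    intro w hw
    simp [rings ρ hρ w hw]
  have f2 : ∀ ρ : List (ℕ × ClaspState), i ∉ ρ.map Prod.fst →
      (ρ.flatMap ring).filter (fun v => !GaussCode.meets (2 * i + 1) v) = ρ.flatMap ring :=
    fun ρ hρ => by
      rw [List.filter_eq_self]
      intro w hw
      simp [rings ρ hρ w hw]
  have r : (σ ++ (i, clasped) :: τ).flatMap ring =
      σ.flatMap ring ++ [(2 * i, false), (2 * i + 1, true)] :: τ.flatMap ring := by
    simp [ring]
  have hr : GaussCode.meets (2 * i + 1) [(2 * i, false), (2 * i + 1, true)] = true := by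
    simp [GaussCode.meets]
  simp only [GaussCode.smooth, claspCode, GaussCode.smoothComps, hm, ha, hb, hm', if_true,
    r, List.filter_append, List.filter_cons, hr, f1 σ hσ, f1 τ hτ, f2 σ hσ, f2 τ hτ]
  simp [GaussCode.after, GaussCode.before, mainArc, ring]

end Moves

/-! ### Crossings first met from below. -/

section Descending

theorem not_idxOf_lt_of_eq_append {α : Type*} [BEq α] [LawfulBEq α] {l p q : List α} {x y : α}
    (h : l = p ++ x :: q) (hy : y ∉ p) : ¬ l.idxOf y < l.idxOf x := by
  have h1 : l.idxOf x ≤ p.length := by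
    rw [h]
    by_cases hx : x ∈ p
    · rw [List.idxOf_append_of_mem hx]
      exact (List.idxOf_lt_length_of_mem hx).le
    · rw [List.idxOf_append_of_notMem hx]
      simp
  have h2 : p.length ≤ l.idxOf y := by
    rw [h, List.idxOf_append_of_notMem hy]
    omega
  omega

end Descending

section BadCrossings

variable {σ : List (ℕ × ClaspState)}

theorem claspCode_passages (σ : List (ℕ × ClaspState)) (sgn : ℕ → Bool) :
    (claspCode σ sgn).passages = σ.flatMap mainArc ++ (σ.flatMap ring).flatten := by
  simp [GaussCode.passages, claspCode]

theorem eq_of_mem_of_mem_mainArc (hσ : (σ.map Prod.fst).Nodup) {c : ℕ × ClaspState} (hc : c ∈ σ)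
    {x : Passage} (h1 : x.1 = 2 * c.1 ∨ x.1 = 2 * c.1 + 1) (hx : x ∈ σ.flatMap mainArc) :
    x ∈ mainArc c := by
  obtain ⟨d, hd, hxd⟩ := List.mem_flatMap.1 hx
  have : d.1 = c.1 := by rcases fst_of_mem_mainArc hxd with h2 | h2 <;> omega
  rwa [← List.inj_on_of_nodup_map hσ hd hc this]

/-- The main component is travelled before all rings. An underpassage on a ring thus comes after its
overpassage, and a kink is met from above first; only the second crossing of a linked clasp remains.
-/
theorem claspCode_badCrossings (hσ : (σ.map Prod.fst).Nodup) (sgn : ℕ → Bool) :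
    (claspCode σ sgn).badCrossings = σ.flatMap bad := by
  have hR : ∀ x ∈ (σ.flatMap ring).flatten, ¬ (!x.2 && decide
      ((claspCode σ sgn).passages.idxOf x < (claspCode σ sgn).passages.idxOf (x.1, true))) = true := by
    rintro ⟨k, b⟩ hx
    obtain ⟨w, hw, hx⟩ := List.mem_flatten.1 hx
    obtain ⟨c, hc, hw⟩ := List.mem_flatMap.1 hw
    cases b
    · have hk := fst_of_mem_ring hw hx
      have h1 : (k, true) ∈ mainArc c := by
        obtain ⟨i, _ | _ | _⟩ := c <;> simp [ring] at hw <;> subst hw <;> simp at hx <;>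
          simp [mainArc, hx]
      have h2 : (k, false) ∉ σ.flatMap mainArc := fun h => by
        have := eq_of_mem_of_mem_mainArc hσ hc hk h
        obtain ⟨i, _ | _ | _⟩ := c <;> simp [ring] at hw <;> subst hw <;>
          simp [mainArc] at hx this
        omega
      have h1' : (k, true) ∈ σ.flatMap mainArc := List.mem_flatMap.2 ⟨c, hc, h1⟩
      rw [claspCode_passages, List.idxOf_append_of_mem h1', List.idxOf_append_of_notMem h2]
      have := List.idxOf_lt_length_of_mem h1'
      simp only [Bool.not_false, Bool.true_and, decide_eq_true_eq]
      omega
    · simp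
  rw [GaussCode.badCrossings]
  conv_lhs => enter [2, 2]; rw [claspCode_passages]
  rw [List.filter_append, List.filter_eq_nil_iff.2 hR, List.append_nil, List.filter_flatMap,
    List.map_flatMap]
  refine List.flatMap_congr fun c hc => ?_
  obtain ⟨pre, post, e⟩ := List.append_of_mem hc
  have hpre : c.1 ∉ pre.map Prod.fst := fun h => by
    rw [e, List.map_append, List.map_cons] at hσ
    exact (List.nodup_append.1 hσ).2.2 _ h _ (by simp) rfl
  obtain ⟨i, _ | _ | _⟩ := c
  · have h1 : (2 * i + 1, false) ∈ σ.flatMap mainArc :=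
      List.mem_flatMap.2 ⟨_, hc, by simp [mainArc]⟩
    have h2 : (2 * i + 1, true) ∉ σ.flatMap mainArc := fun h => by
      have := eq_of_mem_of_mem_mainArc hσ hc (by simp) h
      simp [mainArc] at this
    have := List.idxOf_lt_length_of_mem h1
    simp only [mainArc, bad, claspCode_passages]
    rw [List.filter_cons_of_neg (by simp), List.filter_cons_of_pos]
    · simp
    · rw [List.idxOf_append_of_mem h1, List.idxOf_append_of_notMem h2]
      simp only [Bool.not_false, Bool.true_and, decide_eq_true_eq]
      omega
  · simp [mainArc, bad]
  · have : ¬ (claspCode σ sgn).passages.idxOf (2 * i, false) <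
        (claspCode σ sgn).passages.idxOf (2 * i, true) := by
      refine not_idxOf_lt_of_eq_append (p := pre.flatMap mainArc)
        (q := (2 * i, false) :: (post.flatMap mainArc ++ (σ.flatMap ring).flatten)) ?_ ?_
      · rw [claspCode_passages]
        conv_lhs => enter [1]; rw [e]
        simp [mainArc]
      · intro h
        obtain ⟨d, hd, h⟩ := List.mem_flatMap.1 h
        refine hpre (List.mem_map.2 ⟨d, hd, ?_⟩)
        rcases fst_of_mem_mainArc h with h | h <;> simp at h ⊢ <;> omega
    simp [mainArc, bad, this]

end BadCrossings

/-! ### Skein evaluation of clasp codes. -/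

namespace SkeinParams

variable {R : Type*} [CommRing R] (S : SkeinParams R)

/-- The value of the positive Hopf link. -/
def hopf : R := -(S.linv * (S.linv * S.δ + S.m))

/-- The value of the connected sum of Hopf links and unlinks with the clasps `σ`. -/
def claspValue (σ : List (ℕ × ClaspState)) : R :=
  S.δ ^ σ.countP (fun c => c.2 = unlinked) * S.hopf ^ σ.countP (fun c => c.2 = clasped)

theorem length_flatMap_ring (σ : List (ℕ × ClaspState)) : (σ.flatMap ring).length =
    σ.countP (fun c => c.2 = unlinked) + σ.countP (fun c => c.2 = clasped) := by
  induction σ with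
  | nil => rfl
  | cons c σ ih =>
    obtain ⟨i, _ | _ | _⟩ := c <;> simp [ring, ih] <;> omega

theorem unlink_claspCode (σ : List (ℕ × ClaspState)) (sgn : ℕ → Bool)
    (h : σ.countP (fun c => c.2 = clasped) = 0) :
    S.unlink (claspCode σ sgn) = S.claspValue σ := by
  have := length_flatMap_ring σ
  rw [h] at this
  simp [unlink, claspValue, h, claspCode, -List.length_flatMap, this]

/-- The labels are distinct, and the bad crossing of each clasp is positive. -/
def ClaspsPositive (σ : List (ℕ × ClaspState)) (sgn : ℕ → Bool) : Prop :=
  (σ.map Prod.fst).Nodup ∧ ∀ i, (i, clasped) ∈ σ → sgn (2 * i + 1) = true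

/-- Here `σ` holds the clasps already treated and `τ` those still to come. Changing a crossing
replaces a linked clasp by a free ring (factor `δ`), smoothing it by a kink (factor 1), and the
skein relation combines these into the factor `S.hopf`. The signs must be arbitrary, since each
change alters one. -/
theorem resolve_claspCode (ev : GaussCode → R) (N : ℕ)
    (hev : ∀ σ sgn, ClaspsPositive σ sgn → σ.countP (fun c => c.2 = clasped) < N →
      ev (claspCode σ sgn) = S.claspValue σ) (τ : List (ℕ × ClaspState)) :
    ∀ (σ : List (ℕ × ClaspState)) (sgn : ℕ → Bool), ClaspsPositive (σ ++ τ) sgn →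
      σ.countP (fun c => c.2 = clasped) = 0 → τ.countP (fun c => c.2 = clasped) ≤ N →
      S.resolve ev (τ.flatMap bad) (claspCode (σ ++ τ) sgn) = S.claspValue (σ ++ τ) := by
  induction τ with
  | nil =>
    intro σ sgn _ h _
    rw [List.flatMap_nil, resolve]
    exact S.unlink_claspCode _ _ (by simpa using h)
  | cons c τ ih =>
    intro σ sgn hpos h0 hN
    have shift : σ ++ c :: τ = (σ ++ [c]) ++ τ := by simp
    obtain ⟨i, _ | _ | _⟩ := c
    · have hnd := hpos.1
      rw [List.map_append, List.map_cons] at hnd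
      have hi := List.nodup_middle.1 hnd
      rw [List.nodup_cons, List.mem_append, not_or] at hi
      have hsgn : sgn (2 * i + 1) = true := hpos.2 i (by simp)
      have hne : ∀ j, (j, clasped) ∈ σ ++ τ → j ≠ i := by
        rintro j hj rfl
        rcases List.mem_append.1 hj with hj | hj
        · exact hi.1.1 (List.mem_map.2 ⟨_, hj, rfl⟩)
        · exact hi.1.2 (List.mem_map.2 ⟨_, hj, rfl⟩)
      have hN' : τ.countP (fun c => c.2 = clasped) + 1 ≤ N := by simpa using hN
      have e1 := ih (σ ++ [(i, unlinked)])
        (Function.update sgn (2 * i + 1) (!sgn (2 * i + 1)))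
        ⟨by simpa using hnd, fun j hj => by
          have hj : (j, clasped) ∈ σ ++ τ := by simpa using hj
          have := hne j hj
          rw [Function.update_of_ne (by omega)]
          exact hpos.2 j (by simp at hj ⊢; tauto)⟩
        (by simpa using h0) (by omega)
      have e2 := hev (σ ++ (i, kink) :: τ) sgn
        ⟨by simpa using hnd, fun j hj => hpos.2 j (by simp at hj ⊢; tauto)⟩
        (by simp [h0]; omega)
      rw [List.append_assoc, List.singleton_append] at e1
      simp only [List.flatMap_cons, bad, List.singleton_append, resolve, claspCode, hsgn, if_true]
      -- Reading off the sign unfolded `claspCode`; it is folded back for the two move lemmas.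
      change -(S.linv * (S.linv * S.resolve ev (τ.flatMap bad)
        ((claspCode (σ ++ (i, clasped) :: τ) sgn).switch (2 * i + 1)) +
        S.m * ev ((claspCode (σ ++ (i, clasped) :: τ) sgn).smooth (2 * i + 1)))) = _
      rw [claspCode_switch hi.1.1 hi.1.2, claspCode_smooth hi.1.1 hi.1.2, e1, e2]
      simp [claspValue, List.countP_append, h0]
      rw [hopf]
      ring
    · rw [shift] at hpos ⊢
      exact ih _ sgn hpos (by simpa using h0) (by simpa using hN)
    · rw [shift] at hpos ⊢
      exact ih _ sgn hpos (by simpa using h0) (by simpa using hN)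

/-- The number of linked clasps is enough recursion depth, as every smoothing removes one. -/
theorem evalAux_claspCode (n : ℕ) : ∀ (σ : List (ℕ × ClaspState)) (sgn : ℕ → Bool),
    ClaspsPositive σ sgn → σ.countP (fun c => c.2 = clasped) ≤ n →
      S.evalAux n (claspCode σ sgn) = S.claspValue σ := by
  induction n with
  | zero => exact fun σ sgn _ h => S.unlink_claspCode σ sgn (by omega)
  | succ n ih =>
    intro σ sgn hpos h
    rw [evalAux, claspCode_badCrossings hpos.1]
    exact S.resolve_claspCode _ (n + 1) (fun σ sgn h1 h2 => ih σ sgn h1 (by omega)) σ [] sgn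
      hpos rfl h

end SkeinParams

/-! ### The chain of Hopf links is a plane diagram. -/

section Planarity

/-- The positive diagram of the connected sum of `n` Hopf links. -/
def hopfChain (n : ℕ) : GaussCode :=
  claspCode ((List.range n).map fun i => (i, clasped)) fun _ => true

theorem flatMap_range_mainArc (n : ℕ) :
    ((List.range n).map fun i => (i, clasped)).flatMap mainArc =
      (List.range (2 * n)).map fun k => (k, decide (k % 2 = 0)) := by
  induction n with
  | zero => rfl
  | succ n ih =>
    rw [List.range_succ, List.map_append, List.flatMap_append, ih, mul_add, mul_one,
      List.range_succ, List.range_succ]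
    simp [mainArc]

theorem flatMap_range_ring (n : ℕ) :
    ((List.range n).map fun i => (i, clasped)).flatMap ring =
      (List.range n).map fun i => [(2 * i, false), (2 * i + 1, true)] := by
  induction n with
  | zero => rfl
  | succ n ih =>
    rw [List.range_succ, List.map_append, List.flatMap_append, ih]
    simp [ring]

theorem flatten_range_ring (n : ℕ) :
    ((List.range n).map fun i => ([(2 * i, false), (2 * i + 1, true)] : List Passage)).flatten =
      (List.range (2 * n)).map fun k => (k, !decide (k % 2 = 0)) := by
  induction n with
  | zero => rfl
  | succ n ih =>
    rw [List.range_succ, List.map_append, List.flatten_append, ih, mul_add, mul_one,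
      List.range_succ, List.range_succ]
    simp

theorem hopfChain_comps (n : ℕ) : (hopfChain n).comps =
    ((List.range (2 * n)).map fun k => (k, decide (k % 2 = 0))) ::
      (List.range n).map fun i => [(2 * i, false), (2 * i + 1, true)] := by
  rw [hopfChain, claspCode, flatMap_range_mainArc, flatMap_range_ring]

theorem hopfChain_passages (n : ℕ) : (hopfChain n).passages =
    ((List.range (2 * n)).map fun k => (k, decide (k % 2 = 0))) ++
      (List.range (2 * n)).map fun k => (k, !decide (k % 2 = 0)) := by
  rw [GaussCode.passages, hopfChain_comps, List.flatten_cons, flatten_range_ring]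

theorem mem_hopfChain_passages {n : ℕ} {x : Passage} :
    x ∈ (hopfChain n).passages ↔ x.1 < 2 * n := by
  obtain ⟨k, b⟩ := x
  rw [hopfChain_passages]
  rcases Nat.mod_two_eq_zero_or_one k with h | h <;> cases b <;> simp +contextual [h]

theorem nodup_hopfChain_passages (n : ℕ) : (hopfChain n).passages.Nodup := by
  rw [hopfChain_passages, List.nodup_append]
  refine ⟨List.nodup_range.map fun a b h => congrArg Prod.fst h,
    List.nodup_range.map fun a b h => congrArg Prod.fst h, ?_⟩
  simp only [List.mem_map]
  rintro _ ⟨a, _, rfl⟩ _ ⟨b, _, rfl⟩ h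
  obtain ⟨rfl, h⟩ := Prod.ext_iff.1 h
  simp at h

theorem length_hopfChain_passages (n : ℕ) : (hopfChain n).passages.length = 4 * n := by
  rw [hopfChain_passages]
  simp
  omega

theorem hopfChain_crossings (n : ℕ) : (hopfChain n).crossings = 2 * n := by
  rw [GaussCode.crossings, hopfChain_passages, List.countP_append, List.countP_map,
    List.countP_map]
  have := List.length_eq_countP_add_countP (fun k => decide (k % 2 = 0)) (l := List.range (2 * n))
  rw [List.length_range] at this
  simp only [Function.comp_def]
  convert this.symm using 3
  funext k
  rcases Nat.mod_two_eq_zero_or_one k with h | h <;> simp [h]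

theorem hopfChain_wellFormed (n : ℕ) : (hopfChain n).WellFormed :=
  ⟨by simp [hopfChain_comps], nodup_hopfChain_passages n,
    fun k => by rw [mem_hopfChain_passages, mem_hopfChain_passages]⟩

theorem prod_map_formPerm_apply_of_notMem {α : Type*} [DecidableEq α] {l : List (List α)} {x : α}
    (hx : x ∉ l.flatten) : (l.map List.formPerm).prod x = x := by
  induction l with
  | nil => simp
  | cons v l ih =>
    rw [List.flatten_cons, List.mem_append, not_or] at hx
    rw [List.map_cons, List.prod_cons, Equiv.Perm.mul_apply, ih hx.2,
      List.formPerm_apply_of_notMem hx.1]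

/-- A product of cycles with disjoint supports acts on each of them as the cycle. -/
theorem prod_map_formPerm_apply {α : Type*} [DecidableEq α] {l : List (List α)}
    (h : l.flatten.Nodup) {w : List α} (hw : w ∈ l) {x : α} (hx : x ∈ w) :
    (l.map List.formPerm).prod x = w.formPerm x := by
  induction l with
  | nil => simp at hw
  | cons v l ih =>
    rw [List.flatten_cons, List.nodup_append] at h
    rw [List.map_cons, List.prod_cons, Equiv.Perm.mul_apply]
    rcases List.mem_cons.1 hw with rfl | hw
    · rw [prod_map_formPerm_apply_of_notMem fun hx' => h.2.2 x hx x hx' rfl]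
    · rw [ih h.2.1 hw]
      refine List.formPerm_apply_of_notMem fun hv => ?_
      exact h.2.2 _ hv _ (List.mem_flatten.2 ⟨w, hw, List.formPerm_apply_mem_of_mem hx⟩) rfl

variable {n : ℕ}

theorem hopfChain_next_main {k : ℕ} (hk : k < 2 * n) :
    (hopfChain n).next (k, decide (k % 2 = 0)) =
      ((k + 1) % (2 * n), decide (((k + 1) % (2 * n)) % 2 = 0)) := by
  have hnd := nodup_hopfChain_passages n
  rw [GaussCode.next, prod_map_formPerm_apply hnd
    (w := (List.range (2 * n)).map fun k => (k, decide (k % 2 = 0)))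
    (by simp [hopfChain_comps]) (by simpa using hk)]
  rw [hopfChain_passages] at hnd
  have := List.formPerm_apply_getElem _ hnd.of_append_left k (by simpa using hk)
  simpa using this

theorem hopfChain_next_ring {i : ℕ} (hi : i < n) :
    (hopfChain n).next (2 * i, false) = (2 * i + 1, true) ∧
      (hopfChain n).next (2 * i + 1, true) = (2 * i, false) := by
  have hnd := nodup_hopfChain_passages n
  have hw : [(2 * i, false), (2 * i + 1, true)] ∈ (hopfChain n).comps := by
    rw [hopfChain_comps]
    exact List.mem_cons_of_mem _ (List.mem_map.2 ⟨i, by simpa using hi, rfl⟩)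
  rw [GaussCode.next, prod_map_formPerm_apply hnd hw (by simp),
    prod_map_formPerm_apply hnd hw (by simp), List.formPerm_pair]
  simp

theorem hopfChain_next_succ {k : ℕ} (hk : k + 1 < 2 * n) :
    (hopfChain n).next (k, decide (k % 2 = 0)) = (k + 1, decide ((k + 1) % 2 = 0)) := by
  rw [hopfChain_next_main (by omega), Nat.mod_eq_of_lt hk]

theorem hopfChain_prev {i : ℕ} (hi : i < n) :
    (hopfChain n).prev (2 * i + 1, false) = (2 * i, true) ∧
    (hopfChain n).prev (2 * i, false) = (2 * i + 1, true) ∧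
    (hopfChain n).prev (2 * i + 1, true) = (2 * i, false) := by
  simp only [GaussCode.prev, Equiv.symm_apply_eq, (hopfChain_next_ring hi).1,
    (hopfChain_next_ring hi).2, and_true]
  have := hopfChain_next_succ (n := n) (k := 2 * i) (by omega)
  rw [show 2 * i % 2 = 0 by omega, show (2 * i + 1) % 2 = 1 by omega] at this
  simpa using this.symm

theorem hopfChain_prev_succ {j : ℕ} (hj : j + 1 < n) :
    (hopfChain n).prev (2 * (j + 1), true) = (2 * j + 1, false) := by
  rw [GaussCode.prev, Equiv.symm_apply_eq]
  have := hopfChain_next_succ (n := n) (k := 2 * j + 1) (by omega)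
  rw [show (2 * j + 1) % 2 = 1 by omega, show (2 * j + 1 + 1) % 2 = 0 by omega] at this
  simpa [mul_add] using this.symm

theorem exists_hopfChain_prev {i : ℕ} (hi : i < n) :
    ∃ j, (hopfChain n).prev (2 * i, true) = (2 * j + 1, false) := by
  rcases i with _ | j
  -- The main component closes up: the last clasp precedes the first.
  · refine ⟨n - 1, ?_⟩
    rw [GaussCode.prev, Equiv.symm_apply_eq]
    have := hopfChain_next_main (n := n) (k := 2 * (n - 1) + 1) (by omega)
    rw [show 2 * (n - 1) + 1 + 1 = 2 * n by omega, Nat.mod_self,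
      show (2 * (n - 1) + 1) % 2 = 1 by omega] at this
    simpa using this.symm
  · exact ⟨j, hopfChain_prev_succ hi⟩

theorem hopfChain_prev_of_le {x : Passage} (hx : 2 * n ≤ x.1) : (hopfChain n).prev x = x := by
  rw [GaussCode.prev, Equiv.symm_apply_eq, GaussCode.next, prod_map_formPerm_apply_of_notMem]
  exact fun h => (mem_hopfChain_passages.1 h).not_ge hx

theorem hopfChain_pieces (hn : 0 < n) : (hopfChain n).pieces = 1 := by
  rw [GaussCode.pieces, Nat.card_eq_one_iff_unique]
  set r := fun p q : {x // x ∈ (hopfChain n).passages} =>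
    q.1 = (hopfChain n).next p.1 ∨ q.1.1 = p.1.1
  have key : ∀ k (hk : k < 2 * n) b, Quot.mk r ⟨(k, b), mem_hopfChain_passages.2 hk⟩ =
      Quot.mk r ⟨(0, true), mem_hopfChain_passages.2 (by simp; omega)⟩ := by
    intro k
    induction k with
    | zero => exact fun hk b => Quot.sound (Or.inr rfl)
    | succ k ih =>
      intro hk b
      rw [← ih (by omega) (decide (k % 2 = 0))]
      trans Quot.mk r ⟨(k + 1, decide ((k + 1) % 2 = 0)), mem_hopfChain_passages.2 hk⟩
      · exact Quot.sound (Or.inr rfl)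
      · refine (Quot.sound (r := r) (Or.inl ?_)).symm
        exact (hopfChain_next_succ hk).symm
  refine ⟨⟨fun p q => ?_⟩, ⟨Quot.mk r ⟨(0, true), mem_hopfChain_passages.2 (by simp; omega)⟩⟩⟩
  induction p using Quot.ind with | _ p
  induction q using Quot.ind with | _ q
  exact (key p.1.1 (mem_hopfChain_passages.1 p.2) p.1.2).trans
    (key q.1.1 (mem_hopfChain_passages.1 q.2) q.1.2).symm

/-- Whether a side of an edge bounds a face inside a ring. -/
def isInner (p : Passage × Bool) : Bool :=
  if p.1.1 % 2 = 0 then p.1.2 || !p.2 else p.1.2 && !p.2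

/-- Whether a side of an edge bounds a face to the left of the main component. -/
def isLeft (p : Passage × Bool) : Bool :=
  if p.1.2 = decide (p.1.1 % 2 = 0) then p.2 else decide (p.1.1 % 2 = 0)

/-- The face that a side of an edge bounds: the two faces outside the rings and the two faces
inside each ring lie on the two sides of the main component. -/
def faceOfSide (p : {x // x ∈ (hopfChain n).passages} × Bool) : Option (Fin n) × Bool :=
  (if isInner (p.1.1, p.2) then
    some ⟨p.1.1.1 / 2, by have := mem_hopfChain_passages.1 p.1.2; omega⟩ else none,
    isLeft (p.1.1, p.2))

theorem hopfChain_ne (i : ℕ) : (hopfChain n).ne i = (i, true) := rfl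

theorem hopfChain_nw (i : ℕ) : (hopfChain n).nw i = (i, false) := rfl

/-- This makes `faceOfSide` descend to faces. The index of the clasp is preserved only inside rings,
because the two outer faces run along the whole chain. -/
theorem sameCorner_invariant {p q : Passage × Bool} (h : (hopfChain n).SameCorner p q)
    (hp : p.1.1 < 2 * n) (hq : q.1.1 < 2 * n) :
    isInner p = isInner q ∧ isLeft p = isLeft q ∧ (isInner p = true → p.1.1 / 2 = q.1.1 / 2) := by
  have aux : ∀ k < 2 * n, ∃ i < n, k = 2 * i ∨ k = 2 * i + 1 := fun k hk =>
    ⟨k / 2, by omega, by omega⟩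
  have m0 : ∀ i, 2 * i % 2 = 0 := fun i => by omega
  have m1 : ∀ i, (2 * i + 1) % 2 = 1 := fun i => by omega
  have d1 : ∀ i, (2 * i + 1) / 2 = i := fun i => by omega
  cases h with
  | north k =>
    obtain ⟨i, hi, rfl | rfl⟩ := aux k hp <;>
      simp [hopfChain_ne, hopfChain_nw, isInner, isLeft, m0, m1]
  | west k =>
    obtain ⟨i, hi, rfl | rfl⟩ := aux k hp
    · obtain ⟨j, hj⟩ := exists_hopfChain_prev hi
      simp [hopfChain_ne, hopfChain_nw, hj, isInner, isLeft, m0, m1]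
    · simp [hopfChain_ne, hopfChain_nw, hopfChain_prev hi, isInner, isLeft, m0, m1]
  | south k =>
    -- Both sides at this corner are predecessors, so the bound on `k` comes from `prev` fixing all
    -- labels outside the code.
    have hk : k < 2 * n := by
      by_contra hk
      rw [hopfChain_prev_of_le (by simpa [hopfChain_ne] using hk)] at hp
      exact hk hp
    obtain ⟨i, hi, rfl | rfl⟩ := aux k hk
    · obtain ⟨j, hj⟩ := exists_hopfChain_prev hi
      simp [hopfChain_ne, hopfChain_nw, hopfChain_prev hi, hj, isInner, isLeft, m1]
    · simp [hopfChain_ne, hopfChain_nw, hopfChain_prev hi, isInner, isLeft, m0]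
  | east k =>
    obtain ⟨i, hi, rfl | rfl⟩ := aux k hq
    · simp [hopfChain_ne, hopfChain_nw, hopfChain_prev hi, isInner, isLeft, m0, m1, d1]
    · simp [hopfChain_ne, hopfChain_nw, hopfChain_prev hi, isInner, isLeft, m0, m1, d1]

theorem hopfChain_sameCorner {i : ℕ} (hi : i < n) :
    (hopfChain n).SameCorner ((2 * i, true), true) ((2 * i, false), false) ∧
    (hopfChain n).SameCorner ((2 * i + 1, true), false) ((2 * i, true), false) ∧
    (hopfChain n).SameCorner ((2 * i + 1, false), true) ((2 * i, false), true) ∧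
    (hopfChain n).SameCorner ((2 * i + 1, true), true) ((2 * i + 1, false), false) := by
  have h1 := GaussCode.SameCorner.north (G := hopfChain n) (2 * i)
  have h2 := GaussCode.SameCorner.east (G := hopfChain n) (2 * i)
  have h3 := GaussCode.SameCorner.west (G := hopfChain n) (2 * i + 1)
  have h4 := GaussCode.SameCorner.north (G := hopfChain n) (2 * i + 1)
  simp only [hopfChain_ne, hopfChain_nw, hopfChain_prev hi] at h1 h2 h3 h4
  exact ⟨h1, h2, h3, h4⟩

theorem hopfChain_sameCorner_succ {j : ℕ} (hj : j + 1 < n) :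
    (hopfChain n).SameCorner ((2 * (j + 1), false), true) ((2 * j + 1, false), true) ∧
    (hopfChain n).SameCorner ((2 * j + 1, false), false) ((2 * (j + 1) + 1, true), true) := by
  have h1 := GaussCode.SameCorner.west (G := hopfChain n) (2 * (j + 1))
  have h2 := GaussCode.SameCorner.south (G := hopfChain n) (2 * (j + 1))
  simp only [hopfChain_ne, hopfChain_nw, hopfChain_prev hj, hopfChain_prev_succ hj] at h1 h2
  exact ⟨h1, h2⟩

/-- A side of an edge that bounds the given face. -/
def sideOfFace (hn : 0 < n) : Option (Fin n) × Bool → {x // x ∈ (hopfChain n).passages} × Bool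
  | (some i, s) => (⟨(2 * i, true), mem_hopfChain_passages.2 (by simp)⟩, s)
  | (none, true) => (⟨(0, false), mem_hopfChain_passages.2 (by simpa)⟩, true)
  | (none, false) => (⟨(1, false), mem_hopfChain_passages.2 (by simp; omega)⟩, false)

theorem faceOfSide_sideOfFace (hn : 0 < n) (f : Option (Fin n) × Bool) :
    faceOfSide (sideOfFace hn f) = f := by
  obtain ⟨_ | i, _ | _⟩ := f <;> simp [faceOfSide, sideOfFace, isInner, isLeft]

/-- Inside a ring one corner suffices. Outside, the main edge from one clasp to the next connects
the outer sides of consecutive rings, and induction leads back to the first clasp. -/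
theorem mk_sideOfFace_faceOfSide (hn : 0 < n)
    (p : {x // x ∈ (hopfChain n).passages} × Bool) :
    Quot.mk (fun p q : {x // x ∈ (hopfChain n).passages} × Bool =>
      (hopfChain n).SameCorner (p.1.1, p.2) (q.1.1, q.2)) (sideOfFace hn (faceOfSide p)) =
      Quot.mk _ p := by
  set r := fun p q : {x // x ∈ (hopfChain n).passages} × Bool =>
      (hopfChain n).SameCorner (p.1.1, p.2) (q.1.1, q.2)
  have mem0 : ∀ i < n, ∀ b, (2 * i, b) ∈ (hopfChain n).passages := fun i hi b =>
    mem_hopfChain_passages.2 (by simpa using hi)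
  have mem1 : ∀ i < n, ∀ b, (2 * i + 1, b) ∈ (hopfChain n).passages := fun i hi b =>
    mem_hopfChain_passages.2 (by simp; omega)
  have outerLeft : ∀ i (hi : i < n), Quot.mk r (⟨(2 * i, false), mem0 i hi _⟩, true) =
      Quot.mk r (⟨(0, false), mem0 0 hn _⟩, true) := by
    intro i
    induction i with
    | zero => exact fun _ => rfl
    | succ j ih =>
      intro hj
      rw [← ih (by omega)]
      exact (Quot.sound (r := r) (b := (⟨(2 * j + 1, false), mem1 j (by omega) _⟩, true))
        (hopfChain_sameCorner_succ hj).1).trans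
        (Quot.sound (r := r) (hopfChain_sameCorner (by omega)).2.2.1)
  have outerRight : ∀ i (hi : i < n), Quot.mk r (⟨(2 * i + 1, false), mem1 i hi _⟩, false) =
      Quot.mk r (⟨(1, false), mem1 0 hn _⟩, false) := by
    intro i
    induction i with
    | zero => exact fun _ => rfl
    | succ j ih =>
      intro hj
      rw [← ih (by omega)]
      exact ((Quot.sound (r := r) (b := (⟨(2 * (j + 1) + 1, true), mem1 (j + 1) hj _⟩, true))
        (hopfChain_sameCorner_succ hj).2).trans
        (Quot.sound (r := r) (hopfChain_sameCorner hj).2.2.2)).symm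
  obtain ⟨⟨⟨k, b⟩, hk⟩, s⟩ := p
  have hk' := mem_hopfChain_passages.1 hk
  obtain ⟨i, hi, rfl | rfl⟩ : ∃ i < n, k = 2 * i ∨ k = 2 * i + 1 :=
    ⟨k / 2, by simp at hk'; omega, by omega⟩
  · rcases b with _ | _ <;> rcases s with _ | _ <;>
      simp [faceOfSide, isInner, isLeft, sideOfFace]
    · exact Quot.sound (r := r) (hopfChain_sameCorner hi).1
    · exact (outerLeft i hi).symm
  · have m1 : (2 * i + 1) % 2 = 1 := by omega
    have d1 : (2 * i + 1) / 2 = i := by omega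
    rcases b with _ | _ <;> rcases s with _ | _ <;>
      simp [faceOfSide, isInner, isLeft, sideOfFace, d1]
    · exact (outerRight i hi).symm
    · exact ((Quot.sound (r := r) (hopfChain_sameCorner hi).2.2.1).trans (outerLeft i hi)).symm
    · exact (Quot.sound (r := r) (hopfChain_sameCorner hi).2.1).symm
    · exact ((Quot.sound (r := r) (hopfChain_sameCorner hi).2.2.2).trans (outerRight i hi)).symm

theorem hopfChain_faces (hn : 0 < n) : (hopfChain n).faces = 2 * n + 2 := by
  have e : (Quot fun p q : {x // x ∈ (hopfChain n).passages} × Bool =>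
      (hopfChain n).SameCorner (p.1.1, p.2) (q.1.1, q.2)) ≃ Option (Fin n) × Bool :=
    { toFun := Quot.lift faceOfSide fun p q h => by
        obtain ⟨h1, h2, h3⟩ := sameCorner_invariant h (mem_hopfChain_passages.1 p.1.2)
          (mem_hopfChain_passages.1 q.1.2)
        unfold faceOfSide
        rw [h1] at h3 ⊢
        rw [h2]
        congr 1
        split_ifs with h
        · exact congrArg some (Fin.ext (h3 h))
        · rfl
      invFun := fun f => Quot.mk _ (sideOfFace hn f)
      left_inv := fun p => by
        induction p using Quot.ind with | _ p
        exact mk_sideOfFace_faceOfSide hn p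
      right_inv := faceOfSide_sideOfFace hn }
  rw [GaussCode.faces, Nat.card_congr e, Nat.card_eq_fintype_card]
  simp
  omega

theorem hopfChain_planar (n : ℕ) : (hopfChain n).Planar := by
  rw [GaussCode.Planar, hopfChain_crossings, length_hopfChain_passages]
  rcases n.eq_zero_or_pos with rfl | hn
  -- Without crossings there are neither faces nor pieces, and both sides of Euler's formula are
  -- zero.
  · have : IsEmpty {x // x ∈ (hopfChain 0).passages} :=
      ⟨fun x => by simpa using mem_hopfChain_passages.1 x.2⟩
    simp [GaussCode.faces, GaussCode.pieces]
  · rw [hopfChain_faces hn, hopfChain_pieces hn]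
    omega

end Planarity

/-- The connected sum of `n` positive Hopf links. -/
def hopfSum (n : ℕ) : LinkDiagram where
  code := hopfChain n
  wellFormed := hopfChain_wellFormed n
  planar := hopfChain_planar n

theorem SkeinParams.homfly_hopfSum {R : Type*} [CommRing R] (S : SkeinParams R) (n : ℕ) :
    S.homfly (hopfSum n).code = S.hopf ^ n := by
  have h1 : ((List.range n).map fun i => (i, clasped)).countP (fun c => c.2 = clasped) = n := by
    simp [List.countP_map, Function.comp_def]
  have h2 : ((List.range n).map fun i => (i, clasped)).countP (fun c => c.2 = unlinked) = 0 := by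
    simp [List.countP_map, Function.comp_def]
  rw [homfly, show (hopfSum n).code = hopfChain n from rfl, hopfChain_crossings, hopfChain,
    S.evalAux_claspCode _ _ _ ⟨by simp [Function.comp_def, List.nodup_range], fun _ _ => rfl⟩
      (by omega), claspValue, h1, h2, pow_zero, one_mul]

/-! ### Separated zeros and independence of characters. -/

section Independence

/-- Elements with pairwise separated zeros have distinct monomials. -/
theorem injective_monomials {ι R K : Type*} [Fintype ι] [DecidableEq ι] [CommRing R] [IsDomain R]
    [Field K] {x : ι → R} (hx : ∀ i, x i ≠ 0) (φ : ι → R →+* K) (h0 : ∀ i, φ i (x i) = 0)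
    (h1 : ∀ i j, j ≠ i → φ i (x j) ≠ 0) :
    Function.Injective fun d : ι →₀ ℕ => ∏ i, x i ^ d i := by
  -- Cancel `x i ^ d i` and apply `φ i`: the right side keeps a factor `x i` and dies, the left side
  -- does not.
  have key : ∀ d e : ι →₀ ℕ, ∏ i, x i ^ d i = ∏ i, x i ^ e i → ∀ i, ¬ d i < e i := by
    intro d e h i hlt
    rw [Fintype.prod_eq_mul_prod_compl i, Fintype.prod_eq_mul_prod_compl i] at h
    obtain ⟨k, hk⟩ := Nat.exists_eq_add_of_lt hlt
    rw [hk, add_assoc, pow_add, mul_assoc] at h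
    have h := congrArg (φ i) (mul_left_cancel₀ (pow_ne_zero _ (hx i)) h)
    rw [map_mul, map_pow, h0, zero_pow k.succ_ne_zero, zero_mul, map_prod,
      Finset.prod_eq_zero_iff] at h
    obtain ⟨j, hj, h⟩ := h
    rw [map_pow] at h
    exact h1 i j (by simpa using hj) (eq_zero_of_pow_eq_zero h)
  intro d e h
  ext i
  exact le_antisymm (not_lt.1 (key e d h.symm i)) (not_lt.1 (key d e h i))

/-- Functions are algebraically independent if they take the values `x i ^ n` for elements `x i`
with distinct monomials. -/
theorem algebraicIndependent_of_pow {ι R A : Type*} [Fintype ι] [CommRing R] [IsDomain R]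
    {f : ι → A → R} {x : ι → R} (a : ℕ → A) (ha : ∀ i n, f i (a n) = x i ^ n)
    (hx : Function.Injective fun d : ι →₀ ℕ => ∏ i, x i ^ d i) : AlgebraicIndependent R f := by
  rw [algebraicIndependent_iff]
  intro p hp
  -- Dedekind's theorem for the characters of ℕ attached to the exponents `d`.
  have hli := (linearIndependent_monoidHom (Multiplicative ℕ) R).comp
    (fun d : ι →₀ ℕ => powersHom R (∏ i, x i ^ d i)) ((powersHom R).injective.comp hx)
  rw [linearIndependent_iff'] at hli
  have hsum := hli p.support (fun d => p.coeff d) <| by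
    funext n
    have h := congrFun hp (a n.toAdd)
    rw [MvPolynomial.aeval_def, MvPolynomial.eval₂_eq'] at h
    simpa [ha, Finset.sum_apply, Finset.prod_apply, ← pow_mul, ← Finset.prod_pow, mul_comm]
      using h
  ext d
  by_cases hd : d ∈ p.support
  · exact hsum d hd
  · simpa using hd

open LaurentPolynomial

/-- Evaluation of Laurent polynomials at a unit. -/
noncomputable def evalUnit (z : ℂˣ) : ℂ[T;T⁻¹] →+* ℂ := LaurentPolynomial.eval₂ (RingHom.id ℂ) z

theorem evalUnit_T (z : ℂˣ) (n : ℤ) : evalUnit z (T n) = (z : ℂ) ^ n := by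
  simp [evalUnit]

theorem evalUnit_C (z : ℂˣ) (c : ℂ) : evalUnit z (C c) = c := by
  simp [evalUnit]

/-- Here and in the next two lemmas, clearing denominators exhibits the zeros of the Hopf value as
roots of a polynomial in `z`. -/
theorem evalUnit_hopf_conwayParams (z : ℂˣ) :
    evalUnit z conwayParams.hopf * z = (z : ℂ) ^ 2 - 1 := by
  have hz := z.ne_zero
  simp only [SkeinParams.hopf, conwayParams, map_neg, map_mul, map_add, map_sub, map_zero,
    evalUnit_T, evalUnit_C, zpow_neg, zpow_one]
  field_simp
  linear_combination (1 - (z : ℂ) ^ 2) * Complex.I_sq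

theorem evalUnit_hopf_jonesParams (z : ℂˣ) :
    evalUnit z jonesParams.hopf * (z : ℂ) ^ 5 = -((z : ℂ) ^ 4 + 1) := by
  have hz := z.ne_zero
  have e : ∀ n : ℕ, (z : ℂ) ^ (-(n : ℤ)) = ((z : ℂ) ^ n)⁻¹ := fun n => by simp
  have e2 : (z : ℂ) ^ (-2 : ℤ) = ((z : ℂ) ^ 2)⁻¹ := e 2
  simp only [SkeinParams.hopf, jonesParams, map_neg, map_mul, map_add, map_sub,
    evalUnit_T, evalUnit_C, e2, zpow_neg, zpow_one]
  field_simp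
  linear_combination ((z : ℂ) ^ 4 + 1) * Complex.I_sq

theorem evalUnit_hopf_degenerateParams (z : ℂˣ) :
    evalUnit z degenerateParams.hopf * (2 * (z : ℂ) ^ 3) = 3 * (z : ℂ) ^ 2 - 1 := by
  have hz := z.ne_zero
  simp only [SkeinParams.hopf, degenerateParams, map_neg, map_mul, map_add, map_ofNat,
    evalUnit_T, evalUnit_C, zpow_neg, zpow_one]
  field_simp
  ring

theorem injective_monomials_hopf : Function.Injective fun d : Fin 3 →₀ ℕ =>
    ∏ i, (![conwayParams.hopf, jonesParams.hopf, degenerateParams.hopf] :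
      Fin 3 → ℂ[T;T⁻¹]) i ^ d i := by
  -- The test points are 1 for Conway, `u` with `u ^ 4 = -1` for Jones and `v` with `v ^ 2 = 1 / 3`
  -- for the degenerate polynomial.
  obtain ⟨u, hu⟩ := IsAlgClosed.exists_pow_nat_eq (-1 : ℂ) (n := 4) (by norm_num)
  obtain ⟨v, hv⟩ := IsAlgClosed.exists_pow_nat_eq (1 / 3 : ℂ) (n := 2) (by norm_num)
  have hu0 : u ≠ 0 := by rintro rfl; norm_num at hu
  have hv0 : v ≠ 0 := by rintro rfl; norm_num at hv
  have hc := evalUnit_hopf_conwayParams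
  have hj := evalUnit_hopf_jonesParams
  have hd := evalUnit_hopf_degenerateParams
  have c1 := hc 1
  have j1 := hj 1
  have d1 := hd 1
  have cu := hc (Units.mk0 u hu0)
  have ju := hj (Units.mk0 u hu0)
  have du := hd (Units.mk0 u hu0)
  have cv := hc (Units.mk0 v hv0)
  have jv := hj (Units.mk0 v hv0)
  have dv := hd (Units.mk0 v hv0)
  simp only [Units.val_mk0, Units.val_one] at c1 j1 d1 cu ju du cv jv dv
  have c10 : evalUnit 1 conwayParams.hopf = 0 := by linear_combination c1
  have j10 : evalUnit 1 jonesParams.hopf ≠ 0 := fun h => by rw [h] at j1; norm_num at j1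
  have d10 : evalUnit 1 degenerateParams.hopf ≠ 0 := fun h => by rw [h] at d1; norm_num at d1
  have cu0 : evalUnit (Units.mk0 u hu0) conwayParams.hopf ≠ 0 := fun h => by
    rw [h] at cu
    have : (2 : ℂ) = 0 := by linear_combination ((u ^ 2 + 1)) * cu - hu + 2 * hu
    norm_num at this
  have ju0 : evalUnit (Units.mk0 u hu0) jonesParams.hopf = 0 := by
    rw [hu] at ju
    simpa [hu0] using ju
  have du0 : evalUnit (Units.mk0 u hu0) degenerateParams.hopf ≠ 0 := fun h => by
    rw [h] at du
    -- `(3 * u ^ 2 + 1) * (3 * u ^ 2 - 1) = 9 * u ^ 4 - 1 = -10`.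
    have : (10 : ℂ) = 0 := by linear_combination (3 * u ^ 2 + 1) * du + 9 * hu
    norm_num at this
  have cv0 : evalUnit (Units.mk0 v hv0) conwayParams.hopf ≠ 0 := fun h => by
    rw [h, hv] at cv
    norm_num at cv
  have jv0 : evalUnit (Units.mk0 v hv0) jonesParams.hopf ≠ 0 := fun h => by
    rw [h, show v ^ 4 = (v ^ 2) ^ 2 by ring, hv] at jv
    norm_num at jv
  have dv0 : evalUnit (Units.mk0 v hv0) degenerateParams.hopf = 0 := by
    rw [hv] at dv
    simpa [hv0] using dv
  refine injective_monomials ?_ ![evalUnit 1, evalUnit (Units.mk0 u hu0),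
    evalUnit (Units.mk0 v hv0)] ?_ ?_
  · intro i hi
    fin_cases i <;> simp at hi
    · simp [hi] at cu0
    · simp [hi] at j10
    · simp [hi] at d10
  · intro i
    fin_cases i <;> simpa
  · intro i j hij
    fin_cases i <;> fin_cases j
    exacts [absurd rfl hij, j10, d10, cu0, absurd rfl hij, du0, cv0, jv0, absurd rfl hij]

end Independence

open scoped LaurentPolynomial in
theorem theorem1p11 :
    AlgebraicIndependent ℂ[T;T⁻¹] (![alexanderConway, jones, degenerate] :
      Fin 3 → (LinkDiagram → ℂ[T;T⁻¹])) := by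
  refine algebraicIndependent_of_pow hopfSum (fun i n => ?_) injective_monomials_hopf
  fin_cases i
  exacts [conwayParams.homfly_hopfSum n, jonesParams.homfly_hopfSum n,
    degenerateParams.homfly_hopfSum n]
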